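/- Let $D$ be a commutative Dedekind domain (fields are allowed) and let $\sigma\colon D\to D$ be a ring automorphism. Let $R=D((x;\sigma))$ be the skew Laurent series ring: its elements are the formal series $\sum_{i\ge k}a_ix^i$ with $k\in\mathbb Z$ and $a_i\in D$, added term by term and multiplied according to the rule $x^ia=\sigma^i(a)x^i$ for $a\in D$ and $i\in\mathbb Z$. Then $R$ is a noncommutative Dedekind domain; that is, - $R$ is a domain; - $R$ is noetherian: all left ideals and all right ideals of $R$ are finitely generated; - $R$ is hereditary: all left ideals and all right ideals of $R$ are projective $R$-modules; - $R$ is an Asano order: $R$ has a two-sided classical ring of quotients $Q(R)$, and every nonzero two-sided ideal $I$ of $R$ is invertible, i.e. there is a two-sided fractional ideal $J\subseteq Q(R)$ with $IJ=JI=R$. Furthermore, the ring $R$ is simple if and only if $\sigma(\mathfrak J)\neq\mathfrak J$ for every nonzero proper ideal $\mathfrak J$ of $D$. Here a two-sided fractional ideal is an $R$-subbimodule $J$ of $Q(R)$ that contains a unit of $Q(R)$ and satisfies $cJ\subseteq R$ and $Jd\subseteq R$ for some units $c,d$ of $Q(R)$. -/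

import Mathlib

/-- The skew Laurent series `∑_{i ≥ k} a_i x^i` (`k ∈ ℤ`) over a ring `D` with an automorphism `σ`,
given by their coefficient functions. The coefficients stand to the left of the powers of `x`. -/
@[ext]
structure SkewLaurentSeries {D : Type*} [Ring D] (σ : D ≃+* D) where
  /-- the coefficient of `x ^ i` -/
  coeff : ℤ → D
  /-- only finitely many nonzero coefficients have negative index -/
  bounded : ∃ k : ℤ, ∀ i < k, coeff i = 0

namespace SkewLaurentSeries

variable {D : Type*} [Ring D] {σ : D ≃+* D}

instance : Zero (SkewLaurentSeries σ) :=
  ⟨⟨fun _ => 0, 0, fun _ _ => rfl⟩⟩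

instance : One (SkewLaurentSeries σ) :=
  ⟨⟨fun n => if n = 0 then 1 else 0, 0, fun _ hi => if_neg hi.ne⟩⟩

instance : Add (SkewLaurentSeries σ) :=
  ⟨fun f g => ⟨fun n => f.coeff n + g.coeff n, by
    obtain ⟨a, ha⟩ := f.bounded
    obtain ⟨b, hb⟩ := g.bounded
    refine ⟨min a b, fun i hi => ?_⟩
    rw [ha i (lt_of_lt_of_le hi (min_le_left a b)), hb i (lt_of_lt_of_le hi (min_le_right a b)),
      add_zero]⟩⟩

instance : Neg (SkewLaurentSeries σ) :=
  ⟨fun f => ⟨fun n => -f.coeff n, by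
    obtain ⟨a, ha⟩ := f.bounded
    exact ⟨a, fun i hi => by rw [ha i hi, neg_zero]⟩⟩⟩

/-- Term-wise multiplication with the rule `x ^ i * a = σ ^ i (a) * x ^ i`; at most finitely many
terms of the sum defining a coefficient are nonzero. -/
noncomputable instance : Mul (SkewLaurentSeries σ) :=
  ⟨fun f g => ⟨fun n => ∑ᶠ i : ℤ, f.coeff i * (σ ^ i) (g.coeff (n - i)), by
    obtain ⟨a, ha⟩ := f.bounded
    obtain ⟨b, hb⟩ := g.bounded
    refine ⟨a + b, fun n hn => finsum_eq_zero_of_forall_eq_zero fun i => ?_⟩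
    by_cases hi : i < a
    · rw [ha i hi, zero_mul]
    · rw [hb (n - i) (by lia), map_zero, mul_zero]⟩⟩

@[simp] theorem coeff_zero (n : ℤ) : (0 : SkewLaurentSeries σ).coeff n = 0 := rfl

theorem coeff_one (n : ℤ) : (1 : SkewLaurentSeries σ).coeff n = if n = 0 then 1 else 0 := rfl

@[simp] theorem coeff_add (f g : SkewLaurentSeries σ) (n : ℤ) :
    (f + g).coeff n = f.coeff n + g.coeff n := rfl

@[simp] theorem coeff_neg (f : SkewLaurentSeries σ) (n : ℤ) : (-f).coeff n = -f.coeff n := rfl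

theorem coeff_mul (f g : SkewLaurentSeries σ) (n : ℤ) :
    (f * g).coeff n = ∑ᶠ i : ℤ, f.coeff i * (σ ^ i) (g.coeff (n - i)) := rfl

theorem coeff_mul_eq_sum {f g : SkewLaurentSeries σ} {a b : ℤ} (ha : ∀ i < a, f.coeff i = 0)
    (hb : ∀ i < b, g.coeff i = 0) {n : ℤ} {T : Finset ℤ} (hT : Finset.Icc a (n - b) ⊆ T) :
    (f * g).coeff n = ∑ i ∈ T, f.coeff i * (σ ^ i) (g.coeff (n - i)) := by
  rw [coeff_mul]
  refine finsum_eq_sum_of_support_subset _ fun i hi => hT ?_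
  rw [Function.mem_support] at hi
  rw [Finset.mem_Icc]
  constructor
  · by_contra h
    exact hi (by rw [ha i (by lia), zero_mul])
  · by_contra h
    exact hi (by rw [hb (n - i) (by lia), map_zero, mul_zero])

theorem coeff_mul_eq_zero {f g : SkewLaurentSeries σ} {a b : ℤ} (ha : ∀ i < a, f.coeff i = 0)
    (hb : ∀ i < b, g.coeff i = 0) {n : ℤ} (hn : n < a + b) : (f * g).coeff n = 0 := by
  rw [coeff_mul_eq_sum ha hb (Finset.Subset.refl _), Finset.Icc_eq_empty (by lia),
    Finset.sum_empty]

theorem mul_assoc_aux (f g h : SkewLaurentSeries σ) : f * g * h = f * (g * h) := by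
  obtain ⟨a, ha⟩ := f.bounded
  obtain ⟨b, hb⟩ := g.bounded
  obtain ⟨c, hc⟩ := h.bounded
  ext n
  rw [coeff_mul_eq_sum (T := Finset.Icc (a + b) (n - c)) (fun i hi => coeff_mul_eq_zero ha hb hi) hc
      (Finset.Subset.refl _),
    coeff_mul_eq_sum (T := Finset.Icc a (n - b - c)) ha (fun i hi => coeff_mul_eq_zero hb hc hi)
      (Finset.Icc_subset_Icc le_rfl (by lia))]
  have h1 : ∀ m ∈ Finset.Icc (a + b) (n - c), (f * g).coeff m * (σ ^ m) (h.coeff (n - m)) =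
      ∑ i ∈ Finset.Icc a (n - b - c),
        f.coeff i * (σ ^ i) (g.coeff (m - i)) * (σ ^ m) (h.coeff (n - m)) := by
    intro m hm
    rw [Finset.mem_Icc] at hm
    rw [coeff_mul_eq_sum (T := Finset.Icc a (n - b - c)) ha hb
      (Finset.Icc_subset_Icc le_rfl (by lia)), Finset.sum_mul]
  have h2 : ∀ i ∈ Finset.Icc a (n - b - c), f.coeff i * (σ ^ i) ((g * h).coeff (n - i)) =
      ∑ m ∈ Finset.Icc (a + b) (n - c),
        f.coeff i * (σ ^ i) (g.coeff (m - i)) * (σ ^ m) (h.coeff (n - m)) := by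
    intro i hi
    rw [Finset.mem_Icc] at hi
    rw [coeff_mul_eq_sum (T := (Finset.Icc (a + b) (n - c)).image fun m => m - i) hb hc ?_,
      Finset.sum_image (fun x _ y _ hxy => by simpa using hxy), map_sum, Finset.mul_sum]
    · refine Finset.sum_congr rfl fun m _ => ?_
      have e1 : n - i - (m - i) = n - m := by ring
      have e2 : σ ^ m = σ ^ i * σ ^ (m - i) := by rw [← zpow_add, add_sub_cancel]
      rw [e1, e2, map_mul, mul_assoc]
      rfl
    · intro j hj
      rw [Finset.mem_Icc] at hj
      rw [Finset.mem_image]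
      exact ⟨j + i, Finset.mem_Icc.2 ⟨by lia, by lia⟩, by ring⟩
  rw [Finset.sum_congr rfl h1, Finset.sum_congr rfl h2, Finset.sum_comm]

noncomputable instance : Ring (SkewLaurentSeries σ) where
  add_assoc f g h := by ext n; simp [add_assoc]
  zero_add f := by ext n; simp
  add_zero f := by ext n; simp
  add_comm f g := by ext n; simp [add_comm]
  neg_add_cancel f := by ext n; simp
  nsmul := nsmulRec
  zsmul := zsmulRec
  zero_mul f := by ext n; simp [coeff_mul]
  mul_zero f := by ext n; simp [coeff_mul]
  left_distrib f g h := by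
    obtain ⟨a, ha⟩ := f.bounded
    obtain ⟨b, hb⟩ := g.bounded
    obtain ⟨c, hc⟩ := h.bounded
    have hb' : ∀ i < min b c, g.coeff i = 0 := fun i hi => hb i (by lia)
    have hc' : ∀ i < min b c, h.coeff i = 0 := fun i hi => hc i (by lia)
    ext n
    rw [coeff_add, coeff_mul_eq_sum ha hb' (Finset.Subset.refl _),
      coeff_mul_eq_sum ha hc' (Finset.Subset.refl _),
      coeff_mul_eq_sum ha (fun i hi => by rw [coeff_add, hb' i hi, hc' i hi, add_zero])
        (Finset.Subset.refl _), ← Finset.sum_add_distrib]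
    simp [mul_add]
  right_distrib f g h := by
    obtain ⟨a, ha⟩ := f.bounded
    obtain ⟨b, hb⟩ := g.bounded
    obtain ⟨c, hc⟩ := h.bounded
    have ha' : ∀ i < min a b, f.coeff i = 0 := fun i hi => ha i (by lia)
    have hb' : ∀ i < min a b, g.coeff i = 0 := fun i hi => hb i (by lia)
    ext n
    rw [coeff_add, coeff_mul_eq_sum ha' hc (Finset.Subset.refl _),
      coeff_mul_eq_sum hb' hc (Finset.Subset.refl _),
      coeff_mul_eq_sum (fun i hi => by rw [coeff_add, ha' i hi, hb' i hi, add_zero]) hc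
        (Finset.Subset.refl _), ← Finset.sum_add_distrib]
    simp [add_mul]
  mul_assoc := mul_assoc_aux
  one_mul f := by
    ext n
    rw [coeff_mul, finsum_eq_single _ (0 : ℤ) fun i hi => by rw [coeff_one, if_neg hi, zero_mul]]
    simp [coeff_one]
  mul_one f := by
    ext n
    rw [coeff_mul, finsum_eq_single _ n fun i hi => by
      rw [coeff_one, if_neg (by lia), map_zero, mul_zero]]
    simp [coeff_one]

end SkewLaurentSeries

/-- A ring is noetherian if all its left ideals and all its right ideals are finitely generated. -/
def IsTwoSidedNoetherian (S : Type*) [Ring S] : Prop :=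
  IsNoetherian S S ∧ IsNoetherian Sᵐᵒᵖ S

/-- A ring is hereditary if all its left ideals and all its right ideals are projective. -/
def IsHereditary (S : Type*) [Ring S] : Prop :=
  (∀ I : Submodule S S, Module.Projective S I) ∧
    ∀ I : Submodule Sᵐᵒᵖ S, Module.Projective Sᵐᵒᵖ I

/-- `i : S → Q` exhibits `Q` as the (two-sided) classical ring of quotients of `S`: the regular
elements of `S` become invertible in `Q`, and every element of `Q` can be written as `a s⁻¹` and as
`s⁻¹ a` with `a`, `s` in `S` and `s` regular. For a domain `S` this is its division ring of
fractions; it is unique up to a unique isomorphism over `S`. -/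
structure IsClassicalQuotientRing {S Q : Type*} [Ring S] [Ring Q] (i : S →+* Q) : Prop where
  injective : Function.Injective i
  isUnit : ∀ s ∈ nonZeroDivisors S, IsUnit (i s)
  right_fraction : ∀ q : Q, ∃ a : S, ∃ s ∈ nonZeroDivisors S, q * i s = i a
  left_fraction : ∀ q : Q, ∃ a : S, ∃ s ∈ nonZeroDivisors S, i s * q = i a

/-- A (two-sided) fractional ideal of `S` in `Q`: an `S`-subbimodule `J` of `Q` that contains a unit
of `Q` and satisfies `c J ⊆ S` and `J d ⊆ S` for some units `c`, `d` of `Q`. -/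
structure IsFractionalTwoSidedIdeal {S Q : Type*} [Ring S] [Ring Q] (i : S →+* Q)
    (J : AddSubgroup Q) : Prop where
  left_mul_mem : ∀ s : S, ∀ q ∈ J, i s * q ∈ J
  right_mul_mem : ∀ s : S, ∀ q ∈ J, q * i s ∈ J
  exists_unit_mem : ∃ u : Qˣ, (u : Q) ∈ J
  exists_left_denom : ∃ c : Qˣ, ∀ q ∈ J, (c : Q) * q ∈ i.range
  exists_right_denom : ∃ d : Qˣ, ∀ q ∈ J, q * (d : Q) ∈ i.range

/-- A two-sided ideal `I` of `S` is invertible in `Q` if `I J = S = J I` for some fractional ideal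
`J`, where the product of two additive subgroups is generated by the products of elements. -/
def IsInvertibleTwoSidedIdeal {S Q : Type*} [Ring S] [Ring Q] (i : S →+* Q)
    (I : TwoSidedIdeal S) : Prop :=
  ∃ J : AddSubgroup Q, IsFractionalTwoSidedIdeal i J ∧
    AddSubgroup.closure {q : Q | ∃ a ∈ I, ∃ b ∈ J, q = i a * b} = i.range.toAddSubgroup ∧
    AddSubgroup.closure {q : Q | ∃ b ∈ J, ∃ a ∈ I, q = b * i a} = i.range.toAddSubgroup

/-- `S` is an Asano order: it has a classical ring of quotients (an order in it), and every nonzero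
two-sided ideal of `S` is invertible there. -/
def IsAsanoOrder.{u} (S : Type u) [Ring S] : Prop :=
  ∃ (Q : Type u) (_ : Ring Q) (i : S →+* Q), IsClassicalQuotientRing i ∧
    ∀ I : TwoSidedIdeal S, I ≠ ⊥ → IsInvertibleTwoSidedIdeal i I

/-- A noncommutative Dedekind domain: a noetherian hereditary domain that is an Asano order. -/
structure IsNoncommutativeDedekindDomain (S : Type*) [Ring S] : Prop where
  isDomain : IsDomain S
  isNoetherian : IsTwoSidedNoetherian S
  isHereditary : IsHereditary S
  isAsanoOrder : IsAsanoOrder S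

/-! Let `K` be the fraction field of `D` and extend `σ` to `τ` on `K`. The ring `R` embeds in `K((x;
τ))`, where every nonzero series is a unit because its lowest coefficient is one
(`isUnit_of_ne_zero`).

Let `I` be a nonzero left ideal of `R`. As `x` is a unit, the lowest coefficients of `I` are
governed by one ideal `J` of `D`, that of degree `0`. Since `J` is invertible, `1 = ∑ q_i a_i` with
`a_i ∈ J` and `J q_i ⊆ D`. Lifting the `a_i` to `f_i ∈ I` gives `u = ∑ q_i f_i` with lowest
coefficient `1`, and then `I = A u`, where `A` consists of the series `∑ x ^ n b_n` with `b_n ∈ J`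
(`exists_unit_eq_mul`). So the dual basis of `J` yields one of `I`, and `I` is finitely generated
and projective. Right ideals follow through the anti-isomorphism `reverse` with the series ring of
`σ⁻¹`.

As a noetherian domain, `R` satisfies the Ore conditions, and its division ring of fractions is
found inside `K((x; τ))`. For a nonzero two-sided `I`, the dual bases give one-sided inverses on
both sides. They agree because the multiplier rings of `I` are no larger than `R`
(`exists_map_eq_of_mul_mem` and its mirror image); this uses that `J` is now `σ`-invariant.

The same invariance settles simplicity: a proper nonzero invariant ideal of `D` gives one of `R`,
and a two-sided ideal with `J = D` contains a unit. -/

namespace SkewLaurentSeries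

/-! ### Arithmetic, units and change of coefficients for skew Laurent series -/

section Basic

variable {D : Type*} [Ring D] {σ : D ≃+* D}

/-- The series `a x ^ n`. -/
def monomial (σ : D ≃+* D) (n : ℤ) (a : D) : SkewLaurentSeries σ :=
  ⟨fun m => if m = n then a else 0, n, fun _ hi => if_neg hi.ne⟩

theorem coeff_monomial (n : ℤ) (a : D) (m : ℤ) :
    (monomial σ n a).coeff m = if m = n then a else 0 := rfl

theorem coeff_monomial_mul (n : ℤ) (a : D) (f : SkewLaurentSeries σ) (m : ℤ) :
    (monomial σ n a * f).coeff m = a * (σ ^ n) (f.coeff (m - n)) := by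
  rw [coeff_mul, finsum_eq_single _ n fun i hi => by
    rw [coeff_monomial, if_neg hi, zero_mul], coeff_monomial, if_pos rfl]

theorem coeff_mul_monomial (n : ℤ) (a : D) (f : SkewLaurentSeries σ) (m : ℤ) :
    (f * monomial σ n a).coeff m = f.coeff (m - n) * (σ ^ (m - n)) a := by
  rw [coeff_mul, finsum_eq_single _ (m - n) fun i hi => by
    rw [coeff_monomial, if_neg (by lia), map_zero, mul_zero], coeff_monomial, if_pos (by lia)]

theorem monomial_zero_one : monomial σ 0 1 = 1 := rfl

theorem monomial_mul_monomial (m n : ℤ) (a b : D) :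
    monomial σ m a * monomial σ n b = monomial σ (m + n) (a * (σ ^ m) b) := by
  ext k
  rw [coeff_monomial_mul, coeff_monomial, coeff_monomial]
  by_cases h : k = m + n
  · rw [if_pos h, if_pos (by lia)]
  · rw [if_neg h, if_neg (by lia), map_zero, mul_zero]

theorem coeff_sum {ι : Type*} (s : Finset ι) (f : ι → SkewLaurentSeries σ) (n : ℤ) :
    (∑ i ∈ s, f i).coeff n = ∑ i ∈ s, (f i).coeff n := by
  classical
  induction s using Finset.induction_on with
  | empty => rfl
  | insert i s hi ih => rw [Finset.sum_insert hi, Finset.sum_insert hi, coeff_add, ih]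

theorem coeff_sub (f g : SkewLaurentSeries σ) (n : ℤ) :
    (f - g).coeff n = f.coeff n - g.coeff n := by
  rw [sub_eq_add_neg, coeff_add, coeff_neg, sub_eq_add_neg]

/-- The coefficient of lowest degree of a product. -/
theorem coeff_mul_add {f g : SkewLaurentSeries σ} {a b : ℤ} (ha : ∀ i < a, f.coeff i = 0)
    (hb : ∀ i < b, g.coeff i = 0) :
    (f * g).coeff (a + b) = f.coeff a * (σ ^ a) (g.coeff b) := by
  rw [coeff_mul_eq_sum ha hb (T := {a}) (by simp)]
  simp

theorem exists_lowest_coeff {f : SkewLaurentSeries σ} (hf : f ≠ 0) :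
    ∃ k : ℤ, (∀ i < k, f.coeff i = 0) ∧ f.coeff k ≠ 0 := by
  obtain ⟨b, hb⟩ := f.bounded
  have hex : ∃ k, f.coeff k ≠ 0 := by
    by_contra! h
    exact hf (SkewLaurentSeries.ext (funext h))
  obtain ⟨k, hk, hmin⟩ := Int.exists_least_of_bdd (P := fun k => f.coeff k ≠ 0)
    ⟨b, fun z hz => by by_contra h; exact hz (hb z (by lia))⟩ hex
  refine ⟨k, fun i hi => ?_, hk⟩
  by_contra h
  exact absurd (hmin i h) (by lia)

/-- Strong induction for properties of coefficients, which hold in sufficiently low degrees. -/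
theorem int_strong_induction {P : ℤ → Prop} {b : ℤ} (hb : ∀ n < b, P n)
    (step : ∀ n, (∀ m < n, P m) → P n) (n : ℤ) : P n := by
  by_contra hn
  obtain ⟨k, hk, hmin⟩ := Int.exists_least_of_bdd (P := fun k => ¬ P k)
    ⟨b, fun z hz => by by_contra h; exact hz (hb z (by lia))⟩ ⟨n, hn⟩
  refine hk (step k fun m hm => ?_)
  by_contra h
  exact absurd (hmin m h) (by lia)

instance [Nontrivial D] : Nontrivial (SkewLaurentSeries σ) :=
  ⟨0, 1, fun h => zero_ne_one (congrArg (fun f => f.coeff 0) h)⟩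

instance [NoZeroDivisors D] : NoZeroDivisors (SkewLaurentSeries σ) where
  eq_zero_or_eq_zero_of_mul_eq_zero {f g} h := by
    by_contra! hne
    obtain ⟨a, ha, ha'⟩ := exists_lowest_coeff hne.1
    obtain ⟨b, hb, hb'⟩ := exists_lowest_coeff hne.2
    have := coeff_mul_add ha hb
    rw [h, coeff_zero] at this
    rcases mul_eq_zero.1 this.symm with h | h
    · exact ha' h
    · exact hb' ((map_eq_zero_iff _ (σ ^ a).injective).1 h)

instance [IsDomain D] : IsDomain (SkewLaurentSeries σ) := NoZeroDivisors.to_isDomain _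

/-- The coefficients of the right inverse of a series with constant coefficient `1`. -/
def invCoeff (f : SkewLaurentSeries σ) : ℕ → D
  | n => if n = 0 then 1 else
    -∑ i : Fin n, f.coeff (n - i.1) * (σ ^ ((n : ℤ) - i.1)) (invCoeff f i.1)

theorem invCoeff_of_pos (f : SkewLaurentSeries σ) {n : ℕ} (hn : 0 < n) : f.invCoeff n =
    -∑ i : Fin n, f.coeff (n - i.1) * (σ ^ ((n : ℤ) - i.1)) (invCoeff f i.1) := by
  rw [invCoeff, if_neg hn.ne']

/-- As `f` has constant coefficient `1`, the coefficient of `x ^ n` in `f * g` is `g_n` plus terms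
in `g_k` with `k < n`, so the equations can be solved recursively. -/
theorem exists_mul_eq_one {f : SkewLaurentSeries σ} (h0 : ∀ i < 0, f.coeff i = 0)
    (h1 : f.coeff 0 = 1) :
    ∃ g : SkewLaurentSeries σ, (∀ i < 0, g.coeff i = 0) ∧ g.coeff 0 = 1 ∧ f * g = 1 := by
  have hg0 : ∀ i : ℤ, i < 0 → (if i < 0 then 0 else f.invCoeff i.toNat) = 0 := fun i hi => if_pos hi
  let g : SkewLaurentSeries σ := ⟨fun i => if i < 0 then 0 else f.invCoeff i.toNat, 0, hg0⟩
  have hg1 : g.coeff 0 = 1 := by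
    change (if (0 : ℤ) < 0 then 0 else f.invCoeff (0 : ℤ).toNat) = 1
    rw [if_neg (lt_irrefl _), invCoeff]
    simp
  have hgn : ∀ n : ℕ, g.coeff n = f.invCoeff n := fun n => by
    change (if (n : ℤ) < 0 then 0 else f.invCoeff (n : ℤ).toNat) = _
    rw [if_neg (by lia), Int.toNat_natCast]
  refine ⟨g, hg0, hg1, ?_⟩
  ext n
  rcases lt_or_ge n 0 with hn | hn
  · rw [coeff_mul_eq_zero (g := g) h0 hg0 (by lia), coeff_one, if_neg (by lia)]
  · lift n to ℕ using hn
    rcases Nat.eq_zero_or_pos n with rfl | hpos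
    · have := coeff_mul_add (g := g) h0 hg0
      rw [add_zero] at this
      rw [Nat.cast_zero, this, h1, hg1, map_one, mul_one, coeff_one, if_pos rfl]
    -- The sum is indexed by the degree `k = n - i` of the coefficient of `g`; its last term `k = n`
    -- is `g_n`, and the recursion cancels it against the others.
    · rw [coeff_one, if_neg (by lia), coeff_mul_eq_sum (T := (Finset.range (n + 1)).image
        fun k : ℕ => (n : ℤ) - k) (g := g) h0 hg0 ?_, Finset.sum_image fun x _ y _ hxy => by simpa using hxy,
        Finset.sum_range_succ]
      · have e : ∀ k : ℕ, (n : ℤ) - (n - k) = k := fun k => by ring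
        simp only [e, hgn, sub_self, h1, zpow_zero, RingAut.one_apply, one_mul]
        rw [add_comm, sub_zero, hgn, invCoeff_of_pos f hpos, ← Fin.sum_univ_eq_sum_range
          (fun i => f.coeff (n - i) * (σ ^ ((n : ℤ) - i)) (f.invCoeff i)), neg_add_cancel]
      · intro j hj
        rw [Finset.mem_Icc] at hj
        rw [Finset.mem_image]
        exact ⟨(n - j).toNat, Finset.mem_range.2 (by lia), by lia⟩

/-- The right inverse again has lowest coefficient `1`, so it has a right inverse too, which must be
`f`. -/
theorem exists_inverse {f : SkewLaurentSeries σ} (h0 : ∀ i < 0, f.coeff i = 0)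
    (h1 : f.coeff 0 = 1) :
    ∃ g : SkewLaurentSeries σ, (∀ i < 0, g.coeff i = 0) ∧ g.coeff 0 = 1 ∧ f * g = 1 ∧ g * f = 1 := by
  obtain ⟨g, hg0, hg1, hfg⟩ := exists_mul_eq_one h0 h1
  obtain ⟨h, -, -, hgh⟩ := exists_mul_eq_one hg0 hg1
  have : f = h := by rw [← mul_one f, ← hgh, ← mul_assoc, hfg, one_mul]
  exact ⟨g, hg0, hg1, hfg, this ▸ hgh⟩

theorem isUnit_of_coeff_zero_eq_one {f : SkewLaurentSeries σ} (h0 : ∀ i < 0, f.coeff i = 0)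
    (h1 : f.coeff 0 = 1) : IsUnit f := by
  obtain ⟨g, -, -, hfg, hgf⟩ := exists_inverse h0 h1
  exact ⟨⟨f, g, hfg, hgf⟩, rfl⟩

theorem isUnit_monomial (n : ℤ) {a : D} (ha : IsUnit a) : IsUnit (monomial σ n a) := by
  obtain ⟨a, rfl⟩ := ha
  refine ⟨⟨monomial σ n a, monomial σ (-n) ((σ ^ (-n)) ↑a⁻¹), ?_, ?_⟩, rfl⟩
  · rw [monomial_mul_monomial, ← RingAut.mul_apply, ← zpow_add, add_neg_cancel, zpow_zero,
      RingAut.one_apply, Units.mul_inv, monomial_zero_one]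
  · rw [monomial_mul_monomial, ← map_mul, Units.inv_mul, map_one, neg_add_cancel,
      monomial_zero_one]

/-- A unit monomial on the left moves the lowest term to degree `0` and makes it `1`. -/
theorem isUnit_of_isUnit_coeff {f : SkewLaurentSeries σ} {k : ℤ} (h0 : ∀ i < k, f.coeff i = 0)
    (h1 : IsUnit (f.coeff k)) : IsUnit f := by
  obtain ⟨a, ha⟩ := h1
  have hm : IsUnit (monomial σ (-k) ((σ ^ (-k)) ↑a⁻¹)) := isUnit_monomial _ (a⁻¹.isUnit.map _)
  obtain ⟨m, hm⟩ := hm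
  rw [← Units.isUnit_units_mul m, hm]
  refine isUnit_of_coeff_zero_eq_one (fun i hi => ?_) ?_
  · rw [coeff_monomial_mul, h0 _ (by lia), map_zero, mul_zero]
  · rw [coeff_monomial_mul, sub_neg_eq_add, zero_add, ← ha, ← map_mul, Units.inv_mul, map_one]

theorem isUnit_of_ne_zero {K : Type*} [DivisionRing K] {σ : K ≃+* K} {f : SkewLaurentSeries σ}
    (hf : f ≠ 0) : IsUnit f := by
  obtain ⟨k, h0, h1⟩ := exists_lowest_coeff hf
  exact isUnit_of_isUnit_coeff h0 h1.isUnit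

theorem zpow_map {K : Type*} [Ring K] {τ : K ≃+* K} {φ : D →+* K} (h : ∀ a, τ (φ a) = φ (σ a))
    (i : ℤ) (a : D) : (τ ^ i) (φ a) = φ ((σ ^ i) a) := by
  have hn : ∀ (i : ℕ) (a : D), (τ ^ i) (φ a) = φ ((σ ^ i) a) := fun i => by
    induction i with
    | zero => intro a; rfl
    | succ i ih => intro a; rw [pow_succ, pow_succ, RingAut.mul_apply, RingAut.mul_apply, h, ih]
  cases i with
  | ofNat i => exact_mod_cast hn i a
  | negSucc i =>
    rw [zpow_negSucc, zpow_negSucc, RingAut.inv_apply, RingEquiv.symm_apply_eq, hn,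
      ← RingAut.mul_apply, mul_inv_cancel, RingAut.one_apply]

/-- The ring homomorphism that applies a homomorphism, compatible with the automorphisms, to the
coefficients. -/
noncomputable def map {K : Type*} [Ring K] {τ : K ≃+* K} (φ : D →+* K)
    (h : ∀ a, τ (φ a) = φ (σ a)) : SkewLaurentSeries σ →+* SkewLaurentSeries τ where
  toFun f := ⟨fun n => φ (f.coeff n), by
    obtain ⟨b, hb⟩ := f.bounded
    exact ⟨b, fun i hi => by rw [hb i hi, map_zero]⟩⟩
  map_one' := by ext n; change φ _ = _; rw [coeff_one, coeff_one, apply_ite φ, map_one, map_zero]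
  map_zero' := by ext n; exact map_zero φ
  map_add' _ _ := by ext n; exact map_add φ _ _
  map_mul' f g := by
    obtain ⟨a, ha⟩ := f.bounded
    obtain ⟨b, hb⟩ := g.bounded
    ext n
    rw [coeff_mul_eq_sum (a := a) (b := b) (fun i hi => by simp [ha i hi])
      (fun i hi => by simp [hb i hi]) (Finset.Subset.refl _)]
    change φ _ = _
    rw [coeff_mul_eq_sum ha hb (Finset.Subset.refl _), map_sum]
    exact Finset.sum_congr rfl fun i _ => by rw [map_mul, zpow_map h]

theorem coeff_map {K : Type*} [Ring K] {τ : K ≃+* K} (φ : D →+* K)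
    (h : ∀ a, τ (φ a) = φ (σ a)) (f : SkewLaurentSeries σ) (n : ℤ) :
    (map φ h f).coeff n = φ (f.coeff n) := rfl

theorem map_injective {K : Type*} [Ring K] {τ : K ≃+* K} {φ : D →+* K}
    (h : ∀ a, τ (φ a) = φ (σ a)) (hφ : Function.Injective φ) : Function.Injective (map φ h) :=
  fun _ _ hfg => SkewLaurentSeries.ext (funext fun n => hφ (congrArg (fun f => f.coeff n) hfg))

theorem exists_map_eq {K : Type*} [Ring K] {τ : K ≃+* K} {φ : D →+* K}
    (h : ∀ a, τ (φ a) = φ (σ a)) (hφ : Function.Injective φ) {g : SkewLaurentSeries τ}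
    (hg : ∀ n, ∃ a, φ a = g.coeff n) : ∃ f, map φ h f = g := by
  choose c hc using hg
  obtain ⟨b, hb⟩ := g.bounded
  exact ⟨⟨c, b, fun i hi => hφ (by rw [hc, hb i hi, map_zero])⟩,
    SkewLaurentSeries.ext (funext hc)⟩

/-- The part of a series in degrees below `n`. -/
def trunc (n : ℤ) (f : SkewLaurentSeries σ) : SkewLaurentSeries σ :=
  ⟨fun m => if m < n then f.coeff m else 0, by
    obtain ⟨b, hb⟩ := f.bounded
    exact ⟨b, fun i hi => by rw [hb i hi, ite_self]⟩⟩

theorem coeff_trunc (n : ℤ) (f : SkewLaurentSeries σ) (m : ℤ) :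
    (trunc n f).coeff m = if m < n then f.coeff m else 0 := rfl

theorem coeff_sub_trunc_of_lt (n : ℤ) (f : SkewLaurentSeries σ) {m : ℤ} (hm : m < n) :
    (f - trunc n f).coeff m = 0 := by
  rw [coeff_sub, coeff_trunc, if_pos hm, sub_self]

theorem coeff_sub_trunc_self (n : ℤ) (f : SkewLaurentSeries σ) :
    (f - trunc n f).coeff n = f.coeff n := by
  rw [coeff_sub, coeff_trunc, if_neg (lt_irrefl _), sub_zero]

end Basic

/-! ### The anti-isomorphism that exchanges left and right -/

section Reverse

variable {D : Type*} [CommRing D] {σ τ : D ≃+* D}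

theorem zpow_apply_zpow_apply (h : τ = σ⁻¹) (n : ℤ) (a : D) : (τ ^ n) ((σ ^ n) a) = a := by
  rw [h, ← RingAut.mul_apply, inv_zpow, inv_mul_cancel, RingAut.one_apply]

/-- The anti-isomorphism `∑ a_i x ^ i ↦ ∑ x ^ i a_i` between the skew Laurent series rings of an
automorphism and its inverse. -/
noncomputable def reverse (h : τ = σ⁻¹) :
    SkewLaurentSeries σ ≃+* (SkewLaurentSeries τ)ᵐᵒᵖ where
  toFun f := .op ⟨fun n => (τ ^ n) (f.coeff n), by
    obtain ⟨b, hb⟩ := f.bounded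
    exact ⟨b, fun i hi => by rw [hb i hi, map_zero]⟩⟩
  invFun f := ⟨fun n => (σ ^ n) (f.unop.coeff n), by
    obtain ⟨b, hb⟩ := f.unop.bounded
    exact ⟨b, fun i hi => by rw [hb i hi, map_zero]⟩⟩
  left_inv f := by
    ext n
    change (σ ^ n) ((τ ^ n) (f.coeff n)) = _
    exact zpow_apply_zpow_apply (h ▸ (inv_inv σ).symm) n _
  right_inv f := by
    apply MulOpposite.unop_injective
    ext n
    change (τ ^ n) ((σ ^ n) (f.unop.coeff n)) = _
    exact zpow_apply_zpow_apply h n _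
  map_add' _ _ := by
    apply MulOpposite.unop_injective
    ext n
    exact map_add _ _ _
  map_mul' f g := by
    apply MulOpposite.unop_injective
    ext n
    change (τ ^ n) ((f * g).coeff n) = ∑ᶠ i : ℤ, (τ ^ i) (g.coeff i) *
      (τ ^ i) ((τ ^ (n - i)) (f.coeff (n - i)))
    -- The opposite product swaps the factors, hence the substitution `i ↦ n - i`. Injectivity of `τ
    -- ^ n` lets it pass through the sum without a finiteness argument.
    rw [coeff_mul, ← finsum_comp_equiv (Equiv.subLeft n)]
    refine ((τ ^ n).toAddEquiv.toAddMonoidHom.map_finsum_of_injective (τ ^ n).injective _).trans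
      (finsum_congr fun i => ?_)
    change (τ ^ n) (f.coeff (n - i) * (σ ^ (n - i)) (g.coeff (n - (n - i)))) = _
    have e (a : D) : (τ ^ n) ((σ ^ (n - i)) a) = (τ ^ i) a := by
      rw [← add_sub_cancel i n, zpow_add, RingAut.mul_apply, add_sub_cancel,
        zpow_apply_zpow_apply h]
    rw [map_mul, e, sub_sub_cancel, mul_comm, ← RingAut.mul_apply (τ ^ i), ← zpow_add,
      add_sub_cancel]

end Reverse

/-! ### Lowest coefficients of ideals -/

/-- The ideal of the lowest coefficients of the elements of a left ideal, in degree `0`. -/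
def leadingIdeal {D : Type*} [CommRing D] {σ : D ≃+* D} (I : Ideal (SkewLaurentSeries σ)) :
    Ideal D where
  carrier := {a | ∃ f ∈ I, (∀ i < 0, f.coeff i = 0) ∧ f.coeff 0 = a}
  zero_mem' := ⟨0, I.zero_mem, fun _ _ => rfl, rfl⟩
  add_mem' := by
    rintro a b ⟨f, hf, hf0, rfl⟩ ⟨g, hg, hg0, rfl⟩
    exact ⟨f + g, I.add_mem hf hg, fun i hi => by rw [coeff_add, hf0 i hi, hg0 i hi, add_zero], rfl⟩
  smul_mem' := by
    rintro c a ⟨f, hf, hf0, rfl⟩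
    refine ⟨monomial σ 0 c * f, I.mul_mem_left _ hf, fun i hi => ?_, ?_⟩
    · rw [coeff_monomial_mul, hf0 _ (by lia), map_zero, mul_zero]
    · rw [coeff_monomial_mul]
      rfl

/-- Left multiplication by the unit `x ^ (-n)` brings a lowest term to degree `0`, so degree `0`
controls all degrees. -/
theorem zpow_neg_coeff_mem_leadingIdeal {D : Type*} [CommRing D] {σ : D ≃+* D}
    {I : Ideal (SkewLaurentSeries σ)} {f : SkewLaurentSeries σ} (hf : f ∈ I) {n : ℤ}
    (h0 : ∀ i < n, f.coeff i = 0) : (σ ^ (-n)) (f.coeff n) ∈ leadingIdeal I := by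
  refine ⟨monomial σ (-n) 1 * f, I.mul_mem_left _ hf, fun i hi => ?_, ?_⟩
  · rw [coeff_monomial_mul, h0 _ (by lia), map_zero, mul_zero]
  · rw [coeff_monomial_mul, one_mul, zero_sub, neg_neg]

theorem leadingIdeal_ne_bot {D : Type*} [CommRing D] {σ : D ≃+* D}
    {I : Ideal (SkewLaurentSeries σ)} (hI : I ≠ ⊥) : leadingIdeal I ≠ ⊥ := by
  obtain ⟨f, hf, hf0⟩ := Submodule.exists_mem_ne_zero_of_ne_bot hI
  obtain ⟨k, h0, hk⟩ := exists_lowest_coeff hf0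
  intro h
  have := zpow_neg_coeff_mem_leadingIdeal hf h0
  rw [h, Ideal.mem_bot, map_eq_zero_iff _ (σ ^ (-k)).injective] at this
  exact hk this

/-- Conjugation by `x ^ n` preserves a two-sided ideal and acts on coefficients as `σ ^ n`. -/
theorem zpow_mem_leadingIdeal {D : Type*} [CommRing D] {σ : D ≃+* D}
    {I : TwoSidedIdeal (SkewLaurentSeries σ)} (n : ℤ) {b : D} (hb : b ∈ leadingIdeal I.asIdeal) :
    (σ ^ n) b ∈ leadingIdeal I.asIdeal := by
  obtain ⟨f, hf, hf0, rfl⟩ := hb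
  refine ⟨monomial σ n 1 * f * monomial σ (-n) 1, ?_, fun i hi => ?_, ?_⟩
  · exact I.mul_mem_right _ _ (I.mul_mem_left _ _ hf)
  · rw [coeff_mul_monomial, coeff_monomial_mul, hf0 _ (by lia), map_zero, mul_zero, zero_mul]
  · rw [coeff_mul_monomial, coeff_monomial_mul, map_one, mul_one, one_mul]
    congr 2
    ring

theorem asIdeal_ne_bot {S : Type*} [Ring S] {I : TwoSidedIdeal S} (hI : I ≠ ⊥) :
    I.asIdeal ≠ ⊥ := fun h => hI <| TwoSidedIdeal.ext fun x => by
  rw [← TwoSidedIdeal.mem_asIdeal, h, ← TwoSidedIdeal.mem_asIdeal, TwoSidedIdeal.bot_asIdeal]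

/-- A nonzero ideal of a Dedekind domain has a finite dual basis in the fraction field. -/
theorem exists_dual_basis_of_ne_bot {D : Type*} (K : Type*) [CommRing D] [IsDedekindDomain D]
    [Field K] [Algebra D K] [IsFractionRing D K] {J : Ideal D} (hJ : J ≠ ⊥) :
    ∃ (ι : Type) (_ : Fintype ι) (q : ι → K) (a : ι → D), (∀ i, a i ∈ J) ∧
      (∀ i, ∀ b ∈ J, ∃ d, algebraMap D K d = algebraMap D K b * q i) ∧
      ∑ i, q i * algebraMap D K (a i) = 1 := by
  have hJ' : (J : FractionalIdeal (nonZeroDivisors D) K) ≠ 0 :=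
    FractionalIdeal.coeIdeal_ne_zero.2 hJ
  have h1 : (1 : K) ∈ (J : FractionalIdeal (nonZeroDivisors D) K)⁻¹ * J := by
    rw [inv_mul_cancel₀ hJ']
    exact FractionalIdeal.one_mem_one _
  -- The claim is generalized from `1` to every `x ∈ J⁻¹ J`: products are sums with one term, and
  -- sums are concatenated.
  refine FractionalIdeal.mul_induction_on (C := fun x => ∃ (ι : Type) (_ : Fintype ι) (q : ι → K)
    (a : ι → D), (∀ i, a i ∈ J) ∧ (∀ i, ∀ b ∈ J, ∃ d, algebraMap D K d = algebraMap D K b * q i) ∧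
      ∑ i, q i * algebraMap D K (a i) = x) h1 ?_ ?_
  · intro q hq j hj
    obtain ⟨a, ha, rfl⟩ := (FractionalIdeal.mem_coeIdeal _).1 hj
    refine ⟨Unit, inferInstance, fun _ => q, fun _ => a, fun _ => ha, fun _ b hb => ?_, by simp⟩
    rw [FractionalIdeal.mem_inv_iff hJ'] at hq
    have := hq _ (FractionalIdeal.mem_coeIdeal_of_mem _ hb)
    obtain ⟨d, hd⟩ := (FractionalIdeal.mem_one_iff _).1 this
    exact ⟨d, by rw [hd, mul_comm]⟩
  · rintro x y ⟨ι, _, q, a, h1, h2, rfl⟩ ⟨ι', _, q', a', h1', h2', rfl⟩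
    refine ⟨ι ⊕ ι', inferInstance, Sum.elim q q', Sum.elim a a', ?_, ?_, by simp⟩
    · rintro (i | i)
      exacts [h1 i, h1' i]
    · rintro (i | i)
      exacts [h2 i, h2' i]

/-- The series `∑ x ^ n b_n` with all `b_n` in the ideal `J`. -/
def HasCoeffIn {D K : Type*} [CommRing D] [Field K] [Algebra D K] {τ : K ≃+* K} (J : Ideal D)
    (g : SkewLaurentSeries τ) : Prop :=
  ∀ n, ∃ a ∈ J, (τ ^ n) (algebraMap D K a) = g.coeff n

/-! ### Structure of left ideals, and multiplier rings -/

section LeftIdeal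

variable {D K : Type*} [CommRing D] [Field K] [Algebra D K] {σ : D ≃+* D} {τ : K ≃+* K}

theorem hasCoeffIn_monomial_zero {J : Ideal D} {a : D} (ha : a ∈ J) :
    HasCoeffIn J (monomial τ 0 (algebraMap D K a)) := by
  intro n
  rw [coeff_monomial]
  split_ifs with h
  · exact ⟨a, ha, by rw [h]; rfl⟩
  · exact ⟨0, J.zero_mem, by rw [map_zero, map_zero]⟩

variable [IsFractionRing D K] (hσ : ∀ a, τ (algebraMap D K a) = algebraMap D K (σ a))
include hσ

/-- With the coefficients to the right of the powers of `x`, `(∑ x ^ n b_n) q = ∑ x ^ n (b_n q)`,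
and every `b_n q` lies in `D`. -/
theorem HasCoeffIn.exists_map_eq_mul {J : Ideal D} {g : SkewLaurentSeries τ} (hg : HasCoeffIn J g)
    {q : K} (hq : ∀ b ∈ J, ∃ d, algebraMap D K d = algebraMap D K b * q) :
    ∃ r, map (algebraMap D K) hσ r = g * monomial τ 0 q := by
  refine exists_map_eq hσ (IsFractionRing.injective D K) fun n => ?_
  obtain ⟨b, hb, hbn⟩ := hg n
  obtain ⟨d, hd⟩ := hq b hb
  exact ⟨(σ ^ n) d, by rw [coeff_mul_monomial, sub_zero, ← hbn, ← map_mul, ← hd,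
    zpow_map hσ]⟩

/-- If an element `u` with lowest coefficient `1` conjugates `R` into itself, so does its
inverse. -/
theorem exists_map_eq_of_conj {u v t : SkewLaurentSeries τ} (hu0 : ∀ i < 0, u.coeff i = 0)
    (hu1 : u.coeff 0 = 1) (hv0 : ∀ i < 0, v.coeff i = 0) (hv1 : v.coeff 0 = 1)
    (hconj : ∀ r, ∃ s, map (algebraMap D K) hσ s = u * map (algebraMap D K) hσ r * v)
    (ht : ∃ s, map (algebraMap D K) hσ s = u * t * v) :
    ∃ r, map (algebraMap D K) hσ r = t := by
  refine exists_map_eq hσ (IsFractionRing.injective D K) ?_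
  obtain ⟨b, hb⟩ := t.bounded
  -- If the coefficients of `t` below `n` lie in `D`, then `trunc n t` comes from `R`, so `u (t -
  -- trunc n t) v` does as well. Its coefficient in degree `n` is that of `t`, as `u` and `v` have
  -- lowest coefficient `1`.
  refine int_strong_induction (b := b) (fun n hn => ⟨0, by rw [map_zero, hb n hn]⟩) fun n ih => ?_
  obtain ⟨r, hr⟩ := exists_map_eq hσ (IsFractionRing.injective D K) (g := trunc n t) fun m => by
    rw [coeff_trunc]
    split_ifs with hm
    · exact ih m hm
    · exact ⟨0, map_zero _⟩
  obtain ⟨s, hs⟩ := ht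
  obtain ⟨s', hs'⟩ := hconj r
  refine ⟨(s - s').coeff n, ?_⟩
  have h0 : ∀ i < n, (t - trunc n t).coeff i = 0 := fun i => coeff_sub_trunc_of_lt n t
  have h1 := coeff_mul_add hu0 h0
  have h2 := coeff_mul_add (a := n) (fun i hi => coeff_mul_eq_zero (n := i) hu0 h0 (by lia)) hv0
  rw [zero_add, hu1, one_mul, zpow_zero, RingAut.one_apply, coeff_sub_trunc_self] at h1
  rw [add_zero, h1, hv1, map_one, mul_one, mul_sub, sub_mul] at h2
  rw [← coeff_map _ hσ, map_sub, hs, hs', hr, h2]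

variable [IsDedekindDomain D]

/-- A left ideal `I` with ideal `J` of lowest coefficients is `R J u` for a unit `u` of the skew
Laurent series ring over the fraction field. -/
theorem exists_unit_eq_mul {I : Ideal (SkewLaurentSeries σ)} (hI : I ≠ ⊥) :
    ∃ u : SkewLaurentSeries τ, (∀ i < 0, u.coeff i = 0) ∧ u.coeff 0 = 1 ∧
      (∀ g, HasCoeffIn (leadingIdeal I) g → ∃ f ∈ I, map (algebraMap D K) hσ f = g * u) ∧
      ∀ g, (∃ f ∈ I, map (algebraMap D K) hσ f = g * u) → HasCoeffIn (leadingIdeal I) g := by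
  obtain ⟨ι, _, q, a, ha, hq, hqa⟩ := exists_dual_basis_of_ne_bot K (leadingIdeal_ne_bot hI)
  choose f hf hf0 hfa using ha
  let u : SkewLaurentSeries τ := ∑ i, monomial τ 0 (q i) * map (algebraMap D K) hσ (f i)
  have hu0 : ∀ i < 0, u.coeff i = 0 := fun i hi => by
    rw [coeff_sum]
    refine Finset.sum_eq_zero fun j _ => ?_
    rw [coeff_monomial_mul, coeff_map, hf0 j _ (by lia), map_zero, map_zero, mul_zero]
  have hu1 : u.coeff 0 = 1 := by
    rw [coeff_sum, ← hqa]
    refine Finset.sum_congr rfl fun j _ => ?_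
    rw [coeff_monomial_mul, coeff_map, sub_zero, hfa]
    rfl
  -- `g u = ∑ (g q_i) f_i`, and each `g q_i` lies in `R`.
  have hmul : ∀ g, HasCoeffIn (leadingIdeal I) g →
      ∃ f ∈ I, map (algebraMap D K) hσ f = g * u := fun g hg => by
    choose r hr using fun i => hg.exists_map_eq_mul hσ (hq i)
    refine ⟨∑ i, r i * f i, I.sum_mem fun i _ => I.mul_mem_left _ (hf i), ?_⟩
    rw [map_sum, Finset.mul_sum]
    exact Finset.sum_congr rfl fun i _ => by rw [map_mul, hr, mul_assoc]
  refine ⟨u, hu0, hu1, hmul, fun g ⟨f, hf, hfg⟩ => ?_⟩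
  obtain ⟨b, hb⟩ := g.bounded
  -- By induction, `trunc n g * u` lies in `I`. Subtracting it from `g * u` leaves an element of `I`
  -- with no terms below degree `n`, whose coefficient there is that of `g` because `u` has lowest
  -- coefficient `1`.
  refine int_strong_induction (b := b)
    (fun n hn => ⟨0, Submodule.zero_mem _, by rw [map_zero, map_zero, hb n hn]⟩) fun n ih => ?_
  obtain ⟨f', hf', hfg'⟩ := hmul (trunc n g) fun m => by
    rw [coeff_trunc]
    split_ifs with hm
    · exact ih m hm
    · exact ⟨0, Submodule.zero_mem _, by rw [map_zero, map_zero]⟩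
  have hdiff : map (algebraMap D K) hσ (f - f') = (g - trunc n g) * u := by
    rw [map_sub, hfg, hfg', sub_mul]
  have hlow : ∀ i < n, (f - f').coeff i = 0 := fun i hi => by
    apply IsFractionRing.injective D K
    rw [map_zero, ← coeff_map _ hσ, hdiff,
      coeff_mul_eq_zero (fun i => coeff_sub_trunc_of_lt n g) hu0 (by lia)]
  refine ⟨_, zpow_neg_coeff_mem_leadingIdeal (I.sub_mem hf hf') hlow, ?_⟩
  rw [← zpow_map hσ, ← RingAut.mul_apply, ← zpow_add, add_neg_cancel, zpow_zero,
    RingAut.one_apply, ← coeff_map _ hσ, hdiff]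
  have := coeff_mul_add (fun i => coeff_sub_trunc_of_lt n g) hu0
  rw [add_zero, hu1, map_one, mul_one, coeff_sub_trunc_self] at this
  exact this

/-- A nonzero left ideal has a finite dual basis. -/
theorem exists_dual_basis {I : Ideal (SkewLaurentSeries σ)} (hI : I ≠ ⊥) :
    ∃ (ι : Type) (_ : Fintype ι) (w : ι → SkewLaurentSeries τ) (f : ι → SkewLaurentSeries σ),
      (∀ i, f i ∈ I) ∧
      (∀ i, ∀ g ∈ I, ∃ r, map (algebraMap D K) hσ r = map (algebraMap D K) hσ g * w i) ∧
      ∑ i, w i * map (algebraMap D K) hσ (f i) = 1 := by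
  obtain ⟨u, hu0, hu1, hmem, hcoeff⟩ := exists_unit_eq_mul hσ hI
  obtain ⟨v, -, -, huv, hvu⟩ := exists_inverse hu0 hu1
  obtain ⟨ι, _, q, a, ha, hq, hqa⟩ := exists_dual_basis_of_ne_bot K (leadingIdeal_ne_bot hI)
  choose f hf hfu using fun i => hmem _ (hasCoeffIn_monomial_zero (ha i))
  -- The dual basis `q_i`, `a_i` of `J` is transported along `u`: `w_i = u⁻¹ q_i` and `f_i = a_i u`.
  refine ⟨ι, ‹_›, fun i => v * monomial τ 0 (q i), f, hf, fun i g hg => ?_, ?_⟩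
  · rw [← mul_assoc]
    refine (hcoeff _ ⟨g, hg, ?_⟩).exists_map_eq_mul hσ (hq i)
    rw [mul_assoc, hvu, mul_one]
  · have h1 : ∑ i, monomial τ 0 (q i) * monomial τ 0 (algebraMap D K (a i)) = 1 := by
      rw [← monomial_zero_one, ← hqa]
      ext n
      rw [coeff_sum, coeff_monomial]
      split_ifs with h <;> simp [monomial_mul_monomial, coeff_monomial, h]
    calc _ = v * (∑ i, monomial τ 0 (q i) * monomial τ 0 (algebraMap D K (a i))) * u := by
          rw [Finset.mul_sum, Finset.sum_mul]
          exact Finset.sum_congr rfl fun i _ => by rw [hfu, mul_assoc, mul_assoc, mul_assoc]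
      _ = 1 := by rw [h1, mul_one, hvu]

/-- The right multiplier ring of a nonzero two-sided ideal of `R` is `R`. -/
theorem exists_map_eq_of_mul_mem {I : TwoSidedIdeal (SkewLaurentSeries σ)} (hI : I ≠ ⊥)
    {t : SkewLaurentSeries τ}
    (ht : ∀ f ∈ I, ∃ g ∈ I, map (algebraMap D K) hσ g = map (algebraMap D K) hσ f * t) :
    ∃ r, map (algebraMap D K) hσ r = t := by
  have hI' := asIdeal_ne_bot hI
  obtain ⟨u, hu0, hu1, hmem, hcoeff⟩ := exists_unit_eq_mul hσ hI'
  obtain ⟨v, hv0, hv1, huv, hvu⟩ := exists_inverse hu0 hu1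
  obtain ⟨ι, _, q, a, ha, hq, hqa⟩ := exists_dual_basis_of_ne_bot K (leadingIdeal_ne_bot hI')
  -- From `I = A u` and `I s ⊆ I` follows `A (u s v) ⊆ A`. So `a_i` times the coefficient `c_n` of
  -- `u s v` lies in `σ ^ n (J)`, hence in `J` by invariance; thus `q_i a_i c_n ∈ D`, and summation
  -- over `i` gives `c_n ∈ D`.
  have key : ∀ s : SkewLaurentSeries τ,
      (∀ f ∈ I, ∃ g ∈ I, map (algebraMap D K) hσ g = map (algebraMap D K) hσ f * s) →
      ∃ r, map (algebraMap D K) hσ r = u * s * v := by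
    intro s hs
    refine exists_map_eq hσ (IsFractionRing.injective D K) fun n => ?_
    have h1 : ∀ i, ∃ d, algebraMap D K d = q i * (algebraMap D K (a i) * (u * s * v).coeff n) := by
      intro i
      obtain ⟨f, hf, hfu⟩ := hmem _ (hasCoeffIn_monomial_zero (ha i))
      obtain ⟨g, hg, hgs⟩ := hs f hf
      obtain ⟨b, hb, hbn⟩ := hcoeff (monomial τ 0 (algebraMap D K (a i)) * (u * s * v)) ⟨g, hg, by
        rw [hgs, hfu]; simp only [mul_assoc, hvu, mul_one]⟩ n
      rw [coeff_monomial_mul, sub_zero, zpow_zero, RingAut.one_apply, zpow_map hσ] at hbn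
      obtain ⟨d, hd⟩ := hq i _ (zpow_mem_leadingIdeal n hb)
      exact ⟨d, by rw [hd, hbn, mul_comm]⟩
    choose d hd using h1
    refine ⟨∑ i, d i, ?_⟩
    rw [map_sum, ← one_mul ((u * s * v).coeff n), ← hqa, Finset.sum_mul]
    exact Finset.sum_congr rfl fun i _ => by rw [hd, mul_assoc (q i)]
  -- For `s` in `R`, `key` says that `u R v ⊆ R`; for `s = t`, it provides the element from which
  -- `t` is recovered.
  exact exists_map_eq_of_conj hσ hu0 hu1 hv0 hv1
    (fun r => key _ fun f hf => ⟨f * r, I.mul_mem_right _ _ hf, map_mul _ _ _⟩) (key t ht)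

end LeftIdeal

end SkewLaurentSeries

/-! ### Dual bases and the Ore condition -/

/-- A module with a finite dual basis is finitely generated and projective. -/
theorem Module.finite_and_projective_of_dual_basis {S M ι : Type*} [Ring S] [AddCommGroup M]
    [Module S M] [Fintype ι] (m : ι → M) (φ : ι → M →ₗ[S] S) (h : ∀ x, ∑ i, φ i x • m i = x) :
    Module.Finite S M ∧ Module.Projective S M := by
  have hs : Fintype.linearCombination S m ∘ₗ LinearMap.pi φ = LinearMap.id :=
    LinearMap.ext fun x => by simpa [Fintype.linearCombination_apply] using h x
  exact ⟨Module.Finite.of_surjective (Fintype.linearCombination S m)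
    fun x => ⟨_, LinearMap.congr_fun hs x⟩, Module.Projective.of_split _ _ hs⟩

/-- Without such a relation, `a` and `b` would be left linearly independent and `S ^ 2` would embed
in `S`, which is impossible over a nontrivial noetherian ring. -/
theorem IsNoetherianRing.exists_mul_eq_mul {S : Type*} [Ring S] [IsDomain S] [IsNoetherianRing S]
    (a : S) {b : S} (hb : b ≠ 0) : ∃ t c : S, t ≠ 0 ∧ t * a = c * b := by
  by_contra! h
  have hinj : Function.Injective (Fintype.linearCombination S ![a, b]) := by
    rw [injective_iff_map_eq_zero]
    intro f hf
    rw [Fintype.linearCombination_apply, Fin.sum_univ_two] at hf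
    simp only [Matrix.cons_val_zero, Matrix.cons_val_one, smul_eq_mul] at hf
    have h0 : f 0 = 0 := by
      by_contra h0
      exact h (f 0) (-f 1) h0 (by rw [neg_mul]; exact eq_neg_of_add_eq_zero_left hf)
    have h1 : f 1 = 0 := by simpa [h0, hb] using hf
    ext i
    fin_cases i
    exacts [h0, h1]
  let e := LinearEquiv.funUnique (Fin 1) S S
  have := le_of_fin_injective S (e.symm.toLinearMap ∘ₗ Fintype.linearCombination S ![a, b])
    (e.symm.injective.comp hinj)
  lia

namespace SkewLaurentSeries

/-! ### Finiteness and projectivity of one-sided ideals -/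

section Modules

variable {D K : Type*} [CommRing D] [Field K] [Algebra D K] {σ : D ≃+* D} {τ : K ≃+* K}

theorem inv_algebraMap (hσ : ∀ a, τ (algebraMap D K a) = algebraMap D K (σ a)) (a : D) :
    τ⁻¹ (algebraMap D K a) = algebraMap D K (σ⁻¹ a) := by
  simpa using zpow_map hσ (-1) a

theorem map_reverse_symm (hσ : ∀ a, τ (algebraMap D K a) = algebraMap D K (σ a))
    (f : SkewLaurentSeries σ⁻¹) :
    map (algebraMap D K) hσ ((reverse rfl).symm (.op f)) =
      (reverse rfl).symm (.op (map (algebraMap D K) (inv_algebraMap hσ) f)) := by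
  ext n
  exact (zpow_map hσ n _).symm

theorem exists_reverse_symm_eq (f : SkewLaurentSeries σ) :
    ∃ g : SkewLaurentSeries σ⁻¹, (reverse rfl).symm (.op g) = f :=
  ⟨(reverse rfl f).unop, by rw [MulOpposite.op_unop, RingEquiv.symm_apply_apply]⟩

variable [IsFractionRing D K] [IsDedekindDomain D]
  (hσ : ∀ a, τ (algebraMap D K a) = algebraMap D K (σ a))
include hσ

/-- `reverse` turns a right ideal into a left ideal of the series ring of `σ⁻¹`, and it commutes
with the passage from `D` to `K`. -/
theorem exists_right_dual_basis {I : Submodule (SkewLaurentSeries σ)ᵐᵒᵖ (SkewLaurentSeries σ)}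
    (hI : I ≠ ⊥) :
    ∃ (ι : Type) (_ : Fintype ι) (w : ι → SkewLaurentSeries τ) (f : ι → SkewLaurentSeries σ),
      (∀ i, f i ∈ I) ∧
      (∀ i, ∀ g ∈ I, ∃ r, map (algebraMap D K) hσ r = w i * map (algebraMap D K) hσ g) ∧
      ∑ i, map (algebraMap D K) hσ (f i) * w i = 1 := by
  let I' : Ideal (SkewLaurentSeries σ⁻¹) :=
    { carrier := {g | (reverse rfl).symm (.op g) ∈ I}
      zero_mem' := by simp
      add_mem' := fun {a b} ha hb => by
        rw [Set.mem_ofPred_eq, MulOpposite.op_add, map_add]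
        exact I.add_mem ha hb
      smul_mem' := fun c g hg => by
        rw [Set.mem_ofPred_eq, smul_eq_mul, MulOpposite.op_mul, map_mul]
        exact I.smul_mem (.op ((reverse rfl).symm (.op c))) hg }
  have hI' : I' ≠ ⊥ := by
    obtain ⟨f, hf, hf0⟩ := Submodule.exists_mem_ne_zero_of_ne_bot hI
    obtain ⟨g, rfl⟩ := exists_reverse_symm_eq f
    refine fun h => hf0 ?_
    have hg : g ∈ I' := hf
    rw [h, Ideal.mem_bot] at hg
    rw [hg, MulOpposite.op_zero, map_zero]
  obtain ⟨ι, _, w, f, hf, hw, hsum⟩ := exists_dual_basis (inv_algebraMap hσ) hI'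
  refine ⟨ι, ‹_›, fun i => (reverse rfl).symm (.op (w i)), fun i => (reverse rfl).symm (.op (f i)),
    hf, fun i g hg => ?_, ?_⟩
  · obtain ⟨g, rfl⟩ := exists_reverse_symm_eq g
    obtain ⟨r, hr⟩ := hw i g hg
    refine ⟨(reverse rfl).symm (.op r), ?_⟩
    rw [map_reverse_symm, hr, map_reverse_symm, MulOpposite.op_mul, map_mul]
  · simp only [map_reverse_symm, ← map_mul, ← MulOpposite.op_mul, ← map_sum, ← Finset.op_sum,
      hsum, MulOpposite.op_one, map_one]

/-- The left multiplier ring of a nonzero two-sided ideal of `R` is `R`. -/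
theorem exists_map_eq_of_mul_mem_left {I : TwoSidedIdeal (SkewLaurentSeries σ)} (hI : I ≠ ⊥)
    {t : SkewLaurentSeries τ}
    (ht : ∀ f ∈ I, ∃ g ∈ I, map (algebraMap D K) hσ g = t * map (algebraMap D K) hσ f) :
    ∃ r, map (algebraMap D K) hσ r = t := by
  let I' : TwoSidedIdeal (SkewLaurentSeries σ⁻¹) :=
    .mk' {g | (reverse rfl).symm (.op g) ∈ I} (by simp [I.zero_mem])
      (fun {a b} ha hb => by
        rw [Set.mem_ofPred_eq, MulOpposite.op_add, map_add]
        exact I.add_mem ha hb)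
      (fun {a} ha => by
        rw [Set.mem_ofPred_eq, MulOpposite.op_neg, map_neg]
        exact I.neg_mem ha)
      (fun {a b} hb => by
        rw [Set.mem_ofPred_eq, MulOpposite.op_mul, map_mul]
        exact I.mul_mem_right _ _ hb)
      (fun {a b} ha => by
        rw [Set.mem_ofPred_eq, MulOpposite.op_mul, map_mul]
        exact I.mul_mem_left _ _ ha)
  have hmem : ∀ g, g ∈ I' ↔ (reverse rfl).symm (.op g) ∈ I := fun g => by
    rw [TwoSidedIdeal.mem_mk', Set.mem_ofPred_eq]
  have hI' : I' ≠ ⊥ := fun h => hI <| le_bot_iff.1 fun f hf => by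
    obtain ⟨g, rfl⟩ := exists_reverse_symm_eq f
    have hg := (hmem g).2 hf
    rw [h, TwoSidedIdeal.mem_bot] at hg
    rw [hg, MulOpposite.op_zero, map_zero]
    exact TwoSidedIdeal.zero_mem _
  obtain ⟨t, rfl⟩ := exists_reverse_symm_eq t
  obtain ⟨r, rfl⟩ := exists_map_eq_of_mul_mem (inv_algebraMap hσ) hI' (t := t) fun f hf => by
    obtain ⟨g, hg, hgt⟩ := ht _ ((hmem f).1 hf)
    obtain ⟨g, rfl⟩ := exists_reverse_symm_eq g
    refine ⟨g, (hmem g).2 hg, ?_⟩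
    rw [map_reverse_symm, map_reverse_symm, ← map_mul, ← MulOpposite.op_mul] at hgt
    exact MulOpposite.op_injective ((reverse rfl).symm.injective hgt)
  exact ⟨_, map_reverse_symm hσ r⟩

/-- The coordinate functionals are `g ↦ g w_i`, and `g = ∑ (g w_i) f_i`. -/
theorem finite_and_projective_left (I : Ideal (SkewLaurentSeries σ)) :
    Module.Finite (SkewLaurentSeries σ) I ∧ Module.Projective (SkewLaurentSeries σ) I := by
  rcases eq_or_ne I ⊥ with rfl | hI
  · exact ⟨inferInstance, inferInstance⟩
  obtain ⟨ι, _, w, f, hf, hw, hsum⟩ := exists_dual_basis hσ hI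
  have hinj := map_injective hσ (IsFractionRing.injective D K)
  choose r hr using fun i (g : I) => hw i g g.2
  refine Module.finite_and_projective_of_dual_basis (fun i => (⟨f i, hf i⟩ : I))
    (fun i => { toFun := r i, map_add' := fun x y => hinj ?_, map_smul' := fun c x => hinj ?_ })
    fun g => Subtype.ext (hinj ?_)
  · rw [hr, map_add, hr, hr, Submodule.coe_add, map_add, add_mul]
  · rw [hr, smul_eq_mul, map_mul, RingHom.id_apply, hr, Submodule.coe_smul, smul_eq_mul, map_mul,
      mul_assoc]
  · rw [Submodule.coe_sum, map_sum, ← mul_one (map (algebraMap D K) hσ g), ← hsum, Finset.mul_sum]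
    refine Finset.sum_congr rfl fun i _ => ?_
    rw [Submodule.coe_smul, smul_eq_mul, map_mul, ← mul_assoc, ← hr]
    rfl

theorem finite_and_projective_right
    (I : Submodule (SkewLaurentSeries σ)ᵐᵒᵖ (SkewLaurentSeries σ)) :
    Module.Finite (SkewLaurentSeries σ)ᵐᵒᵖ I ∧ Module.Projective (SkewLaurentSeries σ)ᵐᵒᵖ I := by
  rcases eq_or_ne I ⊥ with rfl | hI
  · exact ⟨inferInstance, inferInstance⟩
  obtain ⟨ι, _, w, f, hf, hw, hsum⟩ := exists_right_dual_basis hσ hI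
  have hinj := map_injective hσ (IsFractionRing.injective D K)
  choose r hr using fun i (g : I) => hw i g g.2
  refine Module.finite_and_projective_of_dual_basis (fun i => (⟨f i, hf i⟩ : I))
    (fun i => { toFun := fun g => .op (r i g)
                map_add' := fun x y => MulOpposite.unop_injective (hinj ?_)
                map_smul' := fun c x => MulOpposite.unop_injective (hinj ?_) })
    fun g => Subtype.ext (hinj ?_)
  · rw [MulOpposite.unop_op, hr, MulOpposite.unop_add, map_add, MulOpposite.unop_op,
      MulOpposite.unop_op, hr, hr, Submodule.coe_add, map_add, mul_add]
  · rw [MulOpposite.unop_op, hr, smul_eq_mul, MulOpposite.unop_mul, map_mul, RingHom.id_apply,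
      MulOpposite.unop_op, hr, Submodule.coe_smul, MulOpposite.smul_eq_mul_unop, map_mul,
      mul_assoc]
  · rw [Submodule.coe_sum, map_sum, ← one_mul (map (algebraMap D K) hσ g), ← hsum, Finset.sum_mul]
    refine Finset.sum_congr rfl fun i _ => ?_
    rw [Submodule.coe_smul, MulOpposite.smul_eq_mul_unop, map_mul, mul_assoc, ← hr]
    rfl

end Modules

/-! ### The division ring of fractions and invertibility of two-sided ideals -/

section Dedekind

variable {D : Type*} [CommRing D] {σ : D ≃+* D}

/-- The extension of an automorphism to the fraction field. -/
noncomputable def fractionAut (σ : D ≃+* D) : FractionRing D ≃+* FractionRing D :=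
  IsFractionRing.ringEquivOfRingEquiv σ

theorem fractionAut_algebraMap (σ : D ≃+* D) (a : D) :
    fractionAut σ (algebraMap D (FractionRing D) a) = algebraMap D (FractionRing D) (σ a) :=
  IsFractionRing.ringEquivOfRingEquiv_algebraMap σ a

/-- The inclusion of `D((x; σ))` into the series with coefficients in the fraction field. -/
noncomputable def toFraction (σ : D ≃+* D) :
    SkewLaurentSeries σ →+* SkewLaurentSeries (fractionAut σ) :=
  map (algebraMap D (FractionRing D)) (fractionAut_algebraMap σ)

theorem toFraction_injective (σ : D ≃+* D) : Function.Injective (toFraction σ) :=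
  map_injective _ (IsFractionRing.injective D _)

variable [IsDedekindDomain D]

instance : IsNoetherianRing (SkewLaurentSeries σ) :=
  ⟨fun I => Module.Finite.iff_fg.1 (finite_and_projective_left (fractionAut_algebraMap σ) I).1⟩

theorem exists_mul_eq_mul_left (a : SkewLaurentSeries σ) {b : SkewLaurentSeries σ} (hb : b ≠ 0) :
    ∃ t c, t ≠ 0 ∧ t * a = c * b :=
  IsNoetherianRing.exists_mul_eq_mul a hb

theorem exists_mul_eq_mul_right (a : SkewLaurentSeries σ) {b : SkewLaurentSeries σ} (hb : b ≠ 0) :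
    ∃ t c, t ≠ 0 ∧ a * t = b * c := by
  obtain ⟨a, rfl⟩ := exists_reverse_symm_eq a
  obtain ⟨b, rfl⟩ := exists_reverse_symm_eq b
  obtain ⟨t, c, ht, h⟩ := exists_mul_eq_mul_left a (b := b) (by rintro rfl; simp at hb)
  refine ⟨(reverse rfl).symm (.op t), (reverse rfl).symm (.op c), by simpa using ht, ?_⟩
  rw [← map_mul, ← MulOpposite.op_mul, h, MulOpposite.op_mul, map_mul]

theorem isTwoSidedNoetherian (σ : D ≃+* D) : IsTwoSidedNoetherian (SkewLaurentSeries σ) :=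
  ⟨inferInstance, ⟨fun I => Module.Finite.iff_fg.1
    (finite_and_projective_right (fractionAut_algebraMap σ) I).1⟩⟩

theorem isHereditary (σ : D ≃+* D) : IsHereditary (SkewLaurentSeries σ) :=
  ⟨fun I => (finite_and_projective_left (fractionAut_algebraMap σ) I).2,
    fun I => (finite_and_projective_right (fractionAut_algebraMap σ) I).2⟩

theorem toFraction_mul_left_injective {s : SkewLaurentSeries σ} (hs : s ≠ 0) :
    Function.Injective (toFraction σ s * ·) :=
  mul_right_injective₀ ((map_ne_zero_iff _ (toFraction_injective σ)).2 hs)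

/-- The division ring of fractions of `D((x; σ))`, inside the series with coefficients in the
fraction field of `D`. -/
noncomputable def quotientRing (σ : D ≃+* D) : Subring (SkewLaurentSeries (fractionAut σ)) where
  carrier := {q | ∃ s a, s ≠ 0 ∧ toFraction σ s * q = toFraction σ a}
  zero_mem' := ⟨1, 0, one_ne_zero, by rw [mul_zero, map_zero]⟩
  one_mem' := ⟨1, 1, one_ne_zero, mul_one _⟩
  neg_mem' := by
    rintro q ⟨s, a, hs, h⟩
    exact ⟨s, -a, hs, by rw [mul_neg, h, map_neg]⟩
  add_mem' := by
    rintro q q' ⟨s, a, hs, h⟩ ⟨s', a', hs', h'⟩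
    -- A common denominator: `t s = c s'` gives `t s (q + q') = t a + c a'`.
    obtain ⟨t, c, ht, e⟩ := exists_mul_eq_mul_left s hs'
    refine ⟨t * s, t * a + c * a', mul_ne_zero ht hs, ?_⟩
    rw [mul_add, map_add, map_mul _ t a, ← h, map_mul _ c a', ← h', ← mul_assoc, ← map_mul,
      ← mul_assoc, ← map_mul, e]
  mul_mem' := by
    rintro q q' ⟨s, a, hs, h⟩ ⟨s', a', hs', h'⟩
    -- Here `t a = c s'` gives `t s q q' = t a q' = c s' q' = c a'`.
    obtain ⟨t, c, ht, e⟩ := exists_mul_eq_mul_left a hs'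
    refine ⟨t * s, c * a', mul_ne_zero ht hs, ?_⟩
    rw [map_mul, mul_assoc, ← mul_assoc _ q, h, ← mul_assoc, ← map_mul, e, map_mul, mul_assoc, h',
      map_mul]

/-- The inclusion of `D((x; σ))` into its division ring of fractions. -/
noncomputable def toQuotientRing (σ : D ≃+* D) : SkewLaurentSeries σ →+* quotientRing σ :=
  (toFraction σ).codRestrict _ fun a => ⟨1, a, one_ne_zero, by rw [map_one, one_mul]⟩

theorem isUnit_toQuotientRing {s : SkewLaurentSeries σ} (hs : s ≠ 0) :
    IsUnit (toQuotientRing σ s) := by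
  obtain ⟨u, hu⟩ := isUnit_of_ne_zero ((map_ne_zero_iff _ (toFraction_injective σ)).2 hs)
  refine ⟨⟨toQuotientRing σ s, ⟨↑u⁻¹, s, 1, hs, ?_⟩, Subtype.ext ?_, Subtype.ext ?_⟩, rfl⟩
  · rw [← hu, Units.mul_inv, map_one]
  · change toFraction σ s * ↑u⁻¹ = 1
    rw [← hu, Units.mul_inv]
  · change ↑u⁻¹ * toFraction σ s = 1
    rw [← hu, Units.inv_mul]

/-- Left fractions are built into `quotientRing`. For right fractions, write `q = s⁻¹ a` and `a t =
s c`; then `q t = c`. -/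
theorem isClassicalQuotientRing (σ : D ≃+* D) : IsClassicalQuotientRing (toQuotientRing σ) where
  injective a b h := toFraction_injective σ (congrArg Subtype.val h)
  isUnit _ hs := isUnit_toQuotientRing (nonZeroDivisors.ne_zero hs)
  left_fraction := by
    rintro ⟨q, s, a, hs, h⟩
    exact ⟨a, s, mem_nonZeroDivisors_of_ne_zero hs, Subtype.ext h⟩
  right_fraction := by
    rintro ⟨q, s, a, hs, h⟩
    obtain ⟨t, c, ht, e⟩ := exists_mul_eq_mul_right a hs
    refine ⟨c, t, mem_nonZeroDivisors_of_ne_zero ht, Subtype.ext ?_⟩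
    refine toFraction_mul_left_injective hs ?_
    change toFraction σ s * (q * toFraction σ t) = toFraction σ s * toFraction σ c
    rw [← mul_assoc, h, ← map_mul, e, map_mul]

/-- The elements `q` of the division ring of fractions with `I q ⊆ R`. -/
def inverseIdeal (I : TwoSidedIdeal (SkewLaurentSeries σ)) : AddSubgroup (quotientRing σ) where
  carrier := {q | ∀ f ∈ I, ∃ r, toQuotientRing σ r = toQuotientRing σ f * q}
  zero_mem' _ _ := ⟨0, by rw [mul_zero, map_zero]⟩
  add_mem' ha hb f hf := by
    obtain ⟨r, hr⟩ := ha f hf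
    obtain ⟨s, hs⟩ := hb f hf
    exact ⟨r + s, by rw [map_add, hr, hs, mul_add]⟩
  neg_mem' ha f hf := by
    obtain ⟨r, hr⟩ := ha f hf
    exact ⟨-r, by rw [map_neg, hr, mul_neg]⟩

variable {I : TwoSidedIdeal (SkewLaurentSeries σ)}

theorem toQuotientRing_mul_mem_inverseIdeal (s : SkewLaurentSeries σ) {q : quotientRing σ}
    (hq : q ∈ inverseIdeal I) : toQuotientRing σ s * q ∈ inverseIdeal I := fun f hf => by
  obtain ⟨r, hr⟩ := hq (f * s) (I.mul_mem_right _ _ hf)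
  exact ⟨r, by rw [hr, map_mul, mul_assoc]⟩

theorem mul_toQuotientRing_mem_inverseIdeal (s : SkewLaurentSeries σ) {q : quotientRing σ}
    (hq : q ∈ inverseIdeal I) : q * toQuotientRing σ s ∈ inverseIdeal I := fun f hf => by
  obtain ⟨r, hr⟩ := hq f hf
  exact ⟨r * s, by rw [map_mul, hr, mul_assoc]⟩

/-- A single nonzero `f ∈ I` with `f w ∈ R` already makes `w` a left fraction. -/
theorem exists_mem_inverseIdeal (hI : I ≠ ⊥) {w : SkewLaurentSeries (fractionAut σ)}
    (hw : ∀ f ∈ I, ∃ r, toFraction σ r = toFraction σ f * w) :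
    ∃ q ∈ inverseIdeal I, (q : SkewLaurentSeries (fractionAut σ)) = w := by
  obtain ⟨f, hf, hf0⟩ := Submodule.exists_mem_ne_zero_of_ne_bot (asIdeal_ne_bot hI)
  obtain ⟨r, hr⟩ := hw f hf
  refine ⟨⟨w, f, r, hf0, hr.symm⟩, fun f hf => ?_, rfl⟩
  obtain ⟨r, hr⟩ := hw f hf
  exact ⟨r, Subtype.ext hr⟩

/-- Since `I q f ⊆ R f ⊆ I`, the element `q f` lies in the right multiplier ring of `I`, which is
`R`. So the right inverse of `I` also works on the left. -/
theorem exists_eq_mul_of_mem_inverseIdeal (hI : I ≠ ⊥) {q : quotientRing σ}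
    (hq : q ∈ inverseIdeal I) {f : SkewLaurentSeries σ} (hf : f ∈ I) :
    ∃ r, toQuotientRing σ r = q * toQuotientRing σ f := by
  obtain ⟨r, hr⟩ := exists_map_eq_of_mul_mem (fractionAut_algebraMap σ) hI
    (t := q * toFraction σ f) fun g hg => by
      obtain ⟨r, hr⟩ := hq g hg
      refine ⟨r * f, I.mul_mem_left _ _ hf, ?_⟩
      rw [map_mul, ← mul_assoc]
      exact congrArg (· * toFraction σ f) (congrArg Subtype.val hr)
  exact ⟨r, Subtype.ext hr⟩

/-- `J I` contains `1`, where `J` is the inverse ideal of `I`. -/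
theorem exists_sum_inverseIdeal_mul (hI : I ≠ ⊥) :
    ∃ (ι : Type) (_ : Fintype ι) (q : ι → quotientRing σ) (f : ι → SkewLaurentSeries σ),
      (∀ i, q i ∈ inverseIdeal I) ∧ (∀ i, f i ∈ I) ∧ ∑ i, q i * toQuotientRing σ (f i) = 1 := by
  obtain ⟨ι, _, w, f, hf, hw, hsum⟩ :=
    exists_dual_basis (fractionAut_algebraMap σ) (asIdeal_ne_bot hI)
  choose q hq hqw using fun i => exists_mem_inverseIdeal hI (hw i)
  refine ⟨ι, ‹_›, q, f, hq, hf, Subtype.ext ?_⟩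
  rw [AddSubmonoidClass.coe_finsetSum, OneMemClass.coe_one, ← hsum]
  exact Finset.sum_congr rfl fun i _ => by rw [← hqw]; rfl

/-- `I J` contains `1`, where `J` is the inverse ideal of `I`. -/
theorem exists_sum_mul_inverseIdeal (hI : I ≠ ⊥) :
    ∃ (ι : Type) (_ : Fintype ι) (q : ι → quotientRing σ) (f : ι → SkewLaurentSeries σ),
      (∀ i, q i ∈ inverseIdeal I) ∧ (∀ i, f i ∈ I) ∧ ∑ i, toQuotientRing σ (f i) * q i = 1 := by
  let I' : Submodule (SkewLaurentSeries σ)ᵐᵒᵖ (SkewLaurentSeries σ) :=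
    { carrier := {f | f ∈ I}
      zero_mem' := I.zero_mem
      add_mem' := I.add_mem
      smul_mem' := fun c f hf => I.mul_mem_right _ _ hf }
  have hI' : I' ≠ ⊥ := fun h => hI <| le_bot_iff.1 fun f hf => by
    have hf' : f ∈ I' := hf
    rw [h, Submodule.mem_bot] at hf'
    rw [hf']
    exact TwoSidedIdeal.zero_mem _
  obtain ⟨ι, _, w, f, hf, hw, hsum⟩ := exists_right_dual_basis (fractionAut_algebraMap σ) hI'
  -- The right dual basis only gives `w_i I ⊆ R`. Then `f w_i I ⊆ f R ⊆ I`, so `f w_i` lies in the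
  -- left multiplier ring, which is `R`.
  have hw' : ∀ i, ∀ f ∈ I, ∃ r, toFraction σ r = toFraction σ f * w i := fun i f hf =>
    exists_map_eq_of_mul_mem_left (fractionAut_algebraMap σ) hI fun g hg => by
      obtain ⟨r, hr⟩ := hw i g hg
      refine ⟨f * r, I.mul_mem_right _ _ hf, ?_⟩
      rw [map_mul, hr, ← mul_assoc]
      rfl
  choose q hq hqw using fun i => exists_mem_inverseIdeal hI (hw' i)
  refine ⟨ι, ‹_›, q, f, hq, hf, Subtype.ext ?_⟩
  rw [AddSubmonoidClass.coe_finsetSum, OneMemClass.coe_one, ← hsum]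
  exact Finset.sum_congr rfl fun i _ => by rw [← hqw]; rfl

/-- Any nonzero element of `I` serves as a denominator on both sides. -/
theorem isFractionalTwoSidedIdeal_inverseIdeal (hI : I ≠ ⊥) :
    IsFractionalTwoSidedIdeal (toQuotientRing σ) (inverseIdeal I) where
  left_mul_mem s _ hq := toQuotientRing_mul_mem_inverseIdeal s hq
  right_mul_mem s _ hq := mul_toQuotientRing_mem_inverseIdeal s hq
  exists_unit_mem := ⟨1, fun f _ => ⟨f, by rw [Units.val_one, mul_one]⟩⟩
  exists_left_denom := by
    obtain ⟨f, hf, hf0⟩ := Submodule.exists_mem_ne_zero_of_ne_bot (asIdeal_ne_bot hI)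
    obtain ⟨u, hu⟩ := isUnit_toQuotientRing hf0
    exact ⟨u, fun q hq => hu ▸ hq f hf⟩
  exists_right_denom := by
    obtain ⟨f, hf, hf0⟩ := Submodule.exists_mem_ne_zero_of_ne_bot (asIdeal_ne_bot hI)
    obtain ⟨u, hu⟩ := isUnit_toQuotientRing hf0
    exact ⟨u, fun q hq => hu ▸ exists_eq_mul_of_mem_inverseIdeal hI hq hf⟩

theorem isInvertibleTwoSidedIdeal (hI : I ≠ ⊥) :
    IsInvertibleTwoSidedIdeal (toQuotientRing σ) I := by
  refine ⟨inverseIdeal I, isFractionalTwoSidedIdeal_inverseIdeal hI, le_antisymm ?_ ?_,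
    le_antisymm ?_ ?_⟩
  · rw [AddSubgroup.closure_le]
    rintro _ ⟨a, ha, b, hb, rfl⟩
    exact hb a ha
  · rintro _ ⟨r, rfl⟩
    obtain ⟨ι, _, q, f, hq, hf, hsum⟩ := exists_sum_mul_inverseIdeal hI
    rw [← one_mul (toQuotientRing σ r), ← hsum, Finset.sum_mul]
    exact AddSubgroup.sum_mem _ fun i _ => AddSubgroup.subset_closure
      ⟨f i, hf i, _, mul_toQuotientRing_mem_inverseIdeal r (hq i), mul_assoc _ _ _⟩
  · rw [AddSubgroup.closure_le]
    rintro _ ⟨b, hb, a, ha, rfl⟩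
    exact exists_eq_mul_of_mem_inverseIdeal hI hb ha
  · rintro _ ⟨r, rfl⟩
    obtain ⟨ι, _, q, f, hq, hf, hsum⟩ := exists_sum_inverseIdeal_mul hI
    rw [← mul_one (toQuotientRing σ r), ← hsum, Finset.mul_sum]
    exact AddSubgroup.sum_mem _ fun i _ => AddSubgroup.subset_closure
      ⟨_, toQuotientRing_mul_mem_inverseIdeal r (hq i), f i, hf i, (mul_assoc _ _ _).symm⟩

theorem isAsanoOrder (σ : D ≃+* D) : IsAsanoOrder (SkewLaurentSeries σ) :=
  ⟨quotientRing σ, inferInstance, toQuotientRing σ, isClassicalQuotientRing σ,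
    fun _ hI => isInvertibleTwoSidedIdeal hI⟩

end Dedekind

/-! ### Simplicity and invariant ideals -/

section Simple

variable {D : Type*} [CommRing D] {σ : D ≃+* D}

theorem zpow_mem_of_map_eq {J : Ideal D} (hJ : J.map σ = J) (n : ℤ) {a : D} (ha : a ∈ J) :
    (σ ^ n) a ∈ J := by
  induction n using Int.induction_on with
  | zero => exact ha
  | succ n ih =>
    rw [add_comm, zpow_one_add, RingAut.mul_apply, ← hJ]
    exact Ideal.mem_map_of_mem σ ih
  | pred n ih =>
    rw [sub_eq_add_neg, add_comm, zpow_add, zpow_neg_one, RingAut.mul_apply, RingAut.inv_apply]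
    rw [← hJ, Ideal.mem_map_of_equiv] at ih
    obtain ⟨b, hb, h⟩ := ih
    rwa [← h, RingEquiv.symm_apply_apply]

/-- The two-sided ideal of the series with coefficients in a `σ`-invariant ideal. -/
noncomputable def coeffIdeal {J : Ideal D} (hJ : J.map σ = J) :
    TwoSidedIdeal (SkewLaurentSeries σ) :=
  .mk' {f | ∀ n, f.coeff n ∈ J} (fun _ => J.zero_mem)
    (fun hf hg n => J.add_mem (hf n) (hg n))
    (fun hf n => J.neg_mem (hf n))
    (fun {f g} hg n => by
      obtain ⟨a, ha⟩ := f.bounded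
      obtain ⟨b, hb⟩ := g.bounded
      rw [coeff_mul_eq_sum ha hb subset_rfl]
      exact J.sum_mem fun i _ => J.mul_mem_left _ (zpow_mem_of_map_eq hJ _ (hg _)))
    (fun {f g} hf n => by
      obtain ⟨a, ha⟩ := f.bounded
      obtain ⟨b, hb⟩ := g.bounded
      rw [coeff_mul_eq_sum ha hb subset_rfl]
      exact J.sum_mem fun i _ => J.mul_mem_right _ (hf _))

theorem mem_coeffIdeal {J : Ideal D} (hJ : J.map σ = J) {f : SkewLaurentSeries σ} :
    f ∈ coeffIdeal hJ ↔ ∀ n, f.coeff n ∈ J := by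
  rw [coeffIdeal, TwoSidedIdeal.mem_mk', Set.mem_ofPred_eq]

theorem map_leadingIdeal (I : TwoSidedIdeal (SkewLaurentSeries σ)) :
    (leadingIdeal I.asIdeal).map σ = leadingIdeal I.asIdeal := by
  refine le_antisymm (Ideal.map_le_iff_le_comap.2 fun a ha => ?_) fun a ha => ?_
  · simpa using zpow_mem_leadingIdeal 1 ha
  · rw [Ideal.mem_map_of_equiv]
    exact ⟨_, zpow_mem_leadingIdeal (-1) ha, by simp [RingAut.inv_apply]⟩

/-- An invariant ideal `J` yields the two-sided ideal `coeffIdeal`, which is proper and nonzero when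
`J` is. Conversely, the lowest coefficients of a nonzero two-sided ideal form a nonzero invariant
ideal; if this is `D`, the ideal contains a series with lowest coefficient `1`, a unit. -/
theorem isSimpleRing_iff [Nontrivial D] : IsSimpleRing (SkewLaurentSeries σ) ↔
    ∀ J : Ideal D, J ≠ ⊥ → J ≠ ⊤ → J.map σ ≠ J := by
  constructor
  · intro _ J hbot htop hJ
    rcases eq_bot_or_eq_top (coeffIdeal hJ) with h | h
    · obtain ⟨a, ha, ha0⟩ := Submodule.exists_mem_ne_zero_of_ne_bot hbot
      have hm : monomial σ 0 a ∈ coeffIdeal hJ := (mem_coeffIdeal hJ).2 fun n => by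
        rw [coeff_monomial]
        split_ifs
        exacts [ha, J.zero_mem]
      rw [h, TwoSidedIdeal.mem_bot] at hm
      exact ha0 (congrArg (fun f => f.coeff 0) hm)
    · have h1 : (1 : SkewLaurentSeries σ) ∈ coeffIdeal hJ := h ▸ TwoSidedIdeal.mem_top _
      exact htop ((Ideal.eq_top_iff_one _).2 ((mem_coeffIdeal hJ).1 h1 0))
  · intro h
    refine ⟨{ eq_bot_or_eq_top := fun I => or_iff_not_imp_left.2 fun hI => ?_ }⟩
    have htop : leadingIdeal I.asIdeal = ⊤ := by
      by_contra htop
      exact h _ (leadingIdeal_ne_bot (asIdeal_ne_bot hI)) htop (map_leadingIdeal I)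
    obtain ⟨f, hf, hf0, hf1⟩ := (Ideal.eq_top_iff_one _).1 htop
    obtain ⟨u, rfl⟩ := isUnit_of_coeff_zero_eq_one hf0 hf1
    rw [← TwoSidedIdeal.one_mem_iff, ← u.inv_mul]
    exact I.mul_mem_left _ _ hf

end Simple

end SkewLaurentSeries

theorem mainTheorem2 {D : Type*} [CommRing D] [IsDedekindDomain D] (σ : D ≃+* D) :
    IsNoncommutativeDedekindDomain (SkewLaurentSeries σ) ∧
      (IsSimpleRing (SkewLaurentSeries σ) ↔
        ∀ 𝔍 : Ideal D, 𝔍 ≠ ⊥ → 𝔍 ≠ ⊤ → Ideal.map σ 𝔍 ≠ 𝔍) :=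
  ⟨⟨inferInstance, SkewLaurentSeries.isTwoSidedNoetherian σ, SkewLaurentSeries.isHereditary σ,
    SkewLaurentSeries.isAsanoOrder σ⟩, SkewLaurentSeries.isSimpleRing_iff⟩
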